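/- Let $n\ge 2$ be even and $0\le i\le n-1$. The involution walk on $S_n$ with parameter $p$ has the following step: choose a uniformly random perfect matching of $\{1,\dots,n\}$ (a fixed point free involution), then independently discard each of its $2$-cycles with probability $p$ and keep it with probability $1-p$. Let $P(g)$ be the probability that the resulting involution is $g\in S_n$ (a polynomial in $p$). For a partition $\lambda$ of $n$ let $\chi_\lambda$ be the irreducible character of $S_n$ indexed by $\lambda$ (the character of the Specht module $S^\lambda$), $d_\lambda=\chi_\lambda(1)$, and let \[ \psi_\lambda=\sum_{g\in S_n}P(g)\frac{\chi_\lambda(g)}{d_\lambda}=\sum_{s=0}^{n/2}\binom{n/2}{s}p^{n/2-s}(1-p)^s\,\frac{\chi_\lambda(1^{n-2s},2^s)}{d_\lambda} \] be the corresponding eigenvalue of the walk. Then for the hook $[n-i,1^i]=(n-i,1,\dots,1)$ and every real $p$ (in particular every $p\in[0,1]$), \[ \psi_{[n-i,1^i]}=\sum_{j}\frac{\binom{n/2-1}{j,\ \frac{i-j}{2},\ \frac{n-i-j-2}{2}}}{\binom{n-1}{i}}(2p)^j(2p-1)^{\frac{i-j}{2}}+\sum_{j}\frac{\binom{n/2-1}{j,\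 \frac{i-j-1}{2},\ \frac{n-i-j-1}{2}}}{\binom{n-1}{i}}(2p)^j(2p-1)^{\frac{i-j-1}{2}+1}. \] Here $\binom{N}{a,b,c}=\frac{N!}{a!\,b!\,c!}$, each sum runs over the integers $j$ for which all three lower entries of its multinomial coefficient are nonnegative integers (so $j\equiv i \pmod 2$ in the first sum and $j\not\equiv i\pmod 2$ in the second), and $0^0=1$. -/

import Mathlib

namespace InvolutionWalk

open Finset

noncomputable section

/-! ### Irreducible characters of the symmetric group (Specht modules) -/

/-- A tabloid, given by the function that sends each entry `x : Fin n` to the index of its row.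
All row assignments are allowed here; the polytabloids of shape `μ` only involve those whose
`r`-th row has `μ.rowLen r` entries. -/
abbrev Tabloid (n : ℕ) : Type := Fin n → ℕ

/-- The permutation representation of the symmetric group on tabloids: `g` moves the entry `x`
to the place of the entry `g x`, that is, `(g • t) (g x) = t x`. -/
def tabloidRep (n : ℕ) : Representation ℂ (Equiv.Perm (Fin n)) (Tabloid n →₀ ℂ) where
  toFun g := Finsupp.lmapDomain ℂ ℂ (fun t : Tabloid n => fun x => t (g⁻¹ x))
  map_one' := by
    ext t
    simp
  map_mul' g h := by
    ext t
    simp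

/-- A Young tableau of shape `μ`: a bijective filling of the cells of `μ` with `Fin n`. There is
one exactly when `μ` has `n` cells. -/
abbrev Tableau (n : ℕ) (μ : YoungDiagram) : Type := {c // c ∈ μ.cells} ≃ Fin n

/-- The tabloid of a tableau; cells are pairs `(row, column)`. -/
def Tableau.tabloid {n : ℕ} {μ : YoungDiagram} (T : Tableau n μ) : Tabloid n :=
  fun x => (T.symm x).1.1

/-- The permutations of the cells of `μ` that preserve every column. -/
def columnGroup (μ : YoungDiagram) : Finset (Equiv.Perm {c // c ∈ μ.cells}) :=
  univ.filter fun σ => ∀ c, (σ c).1.2 = c.1.2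

/-- The polytabloid of a tableau: the signed sum of the tabloids of all its column
rearrangements. -/
def polytabloid {n : ℕ} {μ : YoungDiagram} (T : Tableau n μ) : Tabloid n →₀ ℂ :=
  ∑ σ ∈ columnGroup μ,
    Finsupp.single (Tableau.tabloid (n := n) (μ := μ) (σ.trans T))
      ((Equiv.Perm.sign σ : ℤ) : ℂ)

theorem tabloidRep_polytabloid {n : ℕ} {μ : YoungDiagram} (g : Equiv.Perm (Fin n))
    (T : Tableau n μ) :
    tabloidRep n g (polytabloid T) = polytabloid (n := n) (μ := μ) (T.trans g) := by
  simp only [polytabloid, map_sum]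
  refine Finset.sum_congr rfl fun σ _ => ?_
  simp only [tabloidRep, MonoidHom.coe_mk, OneHom.coe_mk, Finsupp.lmapDomain_apply,
    Finsupp.mapDomain_single]
  rfl

/-- The Specht module of shape `μ`: the span of the polytabloids of shape `μ`. -/
def specht (n : ℕ) (μ : YoungDiagram) : Subrepresentation (tabloidRep n) where
  toSubmodule := Submodule.span ℂ (Set.range fun T : Tableau n μ => polytabloid T)
  apply_mem_toSubmodule g v hv := by
    induction hv using Submodule.span_induction with
    | mem v hv =>
      obtain ⟨T, rfl⟩ := hv
      simp only [tabloidRep_polytabloid]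
      exact Submodule.subset_span ⟨T.trans g, rfl⟩
    | zero => simp
    | add v w _ _ hv hw => simpa using Submodule.add_mem _ hv hw
    | smul a v _ hv => simpa using Submodule.smul_mem _ a hv

/-- The irreducible character `χ_μ` of the symmetric group on `Fin n`, for `μ` with `n` cells. -/
def chi (n : ℕ) (μ : YoungDiagram) (g : Equiv.Perm (Fin n)) : ℂ :=
  LinearMap.trace ℂ (specht n μ).toSubmodule ((specht n μ).toRepresentation g)

/-- The dimension `d_μ` of the irreducible representation indexed by `μ`. -/
def dimSpecht (n : ℕ) (μ : YoungDiagram) : ℕ :=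
  Module.finrank ℂ (specht n μ).toSubmodule

/-! ### The involution walk and its eigenvalues -/

/-- The fixed point free involutions of `Fin n`, i.e. the perfect matchings. -/
def matchings (n : ℕ) : Finset (Equiv.Perm (Fin n)) :=
  univ.filter fun τ => τ * τ = 1 ∧ ∀ x, τ x ≠ x

/-- The step distribution of the involution walk: a uniformly random perfect matching `τ` is
chosen, and each of its `2`-cycles is independently discarded with probability `p` and kept with
probability `1 - p`. The result is `g` when the kept cycles are exactly the cycles of `g`. -/
def step (n : ℕ) (p : ℝ) (g : Equiv.Perm (Fin n)) : ℝ :=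
  (∑ τ ∈ matchings n,
    if g.cycleFactorsFinset ⊆ τ.cycleFactorsFinset then
      p ^ #(τ.cycleFactorsFinset \ g.cycleFactorsFinset) * (1 - p) ^ #g.cycleFactorsFinset
    else 0) / #(matchings n)

/-- The eigenvalue `ψ_μ` of the involution walk: the expected character ratio of one step. -/
def psi (n : ℕ) (p : ℝ) (μ : YoungDiagram) : ℂ :=
  ∑ g : Equiv.Perm (Fin n), (step n p g : ℂ) * (chi n μ g / (dimSpecht n μ : ℂ))

/-! ### Hooks and trinomial coefficients -/

theorem hook_sorted (n i : ℕ) (hi : i < n) : ((n - i) :: List.replicate i 1).SortedGE := by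
  rw [List.sortedGE_iff_pairwise, List.pairwise_cons]
  refine ⟨fun a ha => ?_, List.pairwise_replicate.2 (Or.inr le_rfl)⟩
  have := List.eq_of_mem_replicate ha
  omega

/-- The hook partition `[n - i, 1^i]`. -/
def hook (n i : ℕ) (hi : i < n) : YoungDiagram :=
  YoungDiagram.ofRowLens ((n - i) :: List.replicate i 1) (hook_sorted n i hi)

/-- The trinomial coefficient `N! / (a! b! c!)`, which is `0` unless `a + b + c = N`. -/
def trinomial (N a b c : ℕ) : ℕ :=
  if a + b + c = N then N.factorial / (a.factorial * b.factorial * c.factorial) else 0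

end

end InvolutionWalk

namespace InvolutionWalk

open Finset

noncomputable section

/-! ### The matrix of the standard representation -/

section StandardMatrix

open Polynomial Matrix

/-! The hook Specht module is the `i`-th exterior power of the standard representation, so its
character at `g` is the coefficient of `X ^ i` in `det (1 + X g)`, taken on the standard
representation (`chi_hook`). An involution with `s` two-cycles acts there with eigenvalue `-1` of
multiplicity `s` and `1` of multiplicity `n - 1 - s`, so the determinant is `(1 + X)^(n-1-s) (1 -
X)^s`.

Put `n = 2m`. Summing over the subsets of the `m` cycles of a matching, with weights `p` and `1 -
p`, the binomial theorem gives `(1 + X)^(m-1) (p(1 + X) + (1 - p)(1 - X))^m`, which equals `(1 + 2pX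
+ (2p-1)X^2)^(m-1) (1 + (2p-1)X)` (`sum_matching_chi_hook`). Every matching gives the same
polynomial, so the average is immediate. The two terms of the last factor produce the two sums of
trinomials.

The exterior power is never formed. Coefficients of a Specht vector are alternating and sum to zero
in each slot, so those at tuples avoiding a fixed `z` suffice; on polytabloids they are minors of
`stdMatrix`. -/

theorem reverse_pow_of_domain {R : Type*} [Semiring R] [NoZeroDivisors R] (f : R[X]) (k : ℕ) :
    (f ^ k).reverse = f.reverse ^ k := by
  induction k with
  | zero => simpa using reverse_C (1 : R)
  | succ k ih => rw [pow_succ, reverse_mul_of_domain, ih, pow_succ]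

theorem charpoly_roots_of_mul_self_eq_one {ι : Type*} [Fintype ι] [DecidableEq ι]
    {A : Matrix ι ι ℂ} (hA : A * A = 1) {r : ℂ} (hr : r ∈ A.charpoly.roots) :
    r = 1 ∨ r = -1 := by
  have h1 : r ∈ spectrum ℂ A :=
    Matrix.mem_spectrum_of_isRoot_charpoly (isRoot_of_mem_roots hr)
  have h2 := spectrum.pow_mem_pow A 2 h1
  have : Nonempty ι := by
    by_contra h
    rw [not_nonempty_iff] at h
    have : Subsingleton (Matrix ι ι ℂ) := inferInstance
    simp [spectrum.of_subsingleton] at h1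
  rw [pow_two A, hA, spectrum.one_eq, Set.mem_singleton_iff] at h2
  exact mul_self_eq_one_iff.mp (by rw [← pow_two, h2])

/-- All eigenvalues are `1` or `-1`; the size and the trace give the sum and the difference of the
two multiplicities. -/
theorem det_one_add_X_smul_of_mul_self_eq_one {ι : Type*} [Fintype ι] [DecidableEq ι]
    {A : Matrix ι ι ℂ} (hA : A * A = 1) {a b : ℕ} (hab : a + b = Fintype.card ι)
    (htr : A.trace = (a : ℂ) - b) :
    det (1 + (X : ℂ[X]) • A.map C) = (1 + X) ^ a * (1 - X) ^ b := by
  have hB : (-A) * (-A) = 1 := by rw [neg_mul_neg, hA]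
  set B := -A with hBdef
  -- The reversed characteristic polynomial is `det (1 - X B)`, hence the sign change `B = -A`,
  -- which swaps the two multiplicities.
  have hrev : det (1 + (X : ℂ[X]) • A.map C) = B.charpoly.reverse := by
    rw [reverse_charpoly, charpolyRev, hBdef, Matrix.map_neg C (map_neg C) A, smul_neg,
      sub_neg_eq_add]
  set c := B.charpoly.roots.count 1
  set d := B.charpoly.roots.count (-1)
  have hroots : B.charpoly.roots = Multiset.replicate c 1 + Multiset.replicate d (-1) := by
    ext r
    rw [Multiset.count_add, Multiset.count_replicate, Multiset.count_replicate]
    have h11 : (1 : ℂ) ≠ -1 := by norm_num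
    by_cases h1 : r = 1
    · subst h1; simp [h11.symm, c]
    by_cases h2 : r = -1
    · subst h2; simp [h11, d]
    · rw [Multiset.count_eq_zero_of_notMem, if_neg (Ne.symm h1), if_neg (Ne.symm h2)]
      exact fun h => (charpoly_roots_of_mul_self_eq_one hB h).elim h1 h2
  have hsplit : B.charpoly = (X - 1) ^ c * (X + 1) ^ d := by
    have := (IsAlgClosed.splits B.charpoly).eq_prod_roots_of_monic B.charpoly_monic
    rw [this, hroots]
    simp
  have hdeg : c + d = a + b := by
    rw [hab, ← B.charpoly_natDegree_eq_dim,
      (IsAlgClosed.splits B.charpoly).natDegree_eq_card_roots, hroots]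
    simp
  have htr' : (c : ℂ) - d = b - a := by
    have := B.trace_eq_sum_roots_charpoly
    rw [hroots, hBdef, trace_neg, htr] at this
    simp at this
    linear_combination -this
  have hcd : (c : ℤ) - d = b - a := by exact_mod_cast htr'
  obtain rfl : c = b := by omega
  obtain rfl : d = a := by omega
  rw [hrev, hsplit, reverse_mul_of_domain, reverse_pow_of_domain, reverse_pow_of_domain]
  have r1 : (X - 1 : ℂ[X]).reverse = 1 - X := by
    have hd : (X - C 1 : ℂ[X]).natDegree = 1 := natDegree_X_sub_C 1
    rw [← C_1, reverse, hd]
    simp [reflect_sub]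
  have r2 : (X + 1 : ℂ[X]).reverse = 1 + X := by
    have hd : (X + C 1 : ℂ[X]).natDegree = 1 := natDegree_X_add_C 1
    rw [← C_1, reverse, hd]
    simp [reflect_add]
  rw [r1, r2, mul_comm]

/-- The matrix of `g` on the standard representation, in the basis of the differences of the basis
vectors indexed by `x ≠ z` with the basis vector indexed by `z`. -/
def stdMatrix {α : Type*} [DecidableEq α] (z : α) (g : Equiv.Perm α) :
    Matrix {x // x ≠ z} {x // x ≠ z} ℂ :=
  Matrix.of fun x y => (if x.1 = g y.1 then 1 else 0) - if x.1 = g z then 1 else 0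

theorem stdMatrix_one {α : Type*} [DecidableEq α] (z : α) : stdMatrix z 1 = 1 := by
  ext x y
  simp [stdMatrix, x.2, Matrix.one_apply, Subtype.ext_iff]
  congr

variable {α : Type*} [Fintype α] [DecidableEq α] (z : α)

theorem stdMatrix_mul (g h : Equiv.Perm α) :
    stdMatrix z g * stdMatrix z h = stdMatrix z (g * h) := by
  -- `w = z` is allowed: it stands for the zero vector `e_z - e_z`, and both sides vanish.
  have key (x : {x // x ≠ z}) (w : α) :
      ∑ y : {x // x ≠ z}, stdMatrix z g x y * (if y.1 = w then 1 else 0)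
        = (if x.1 = g w then 1 else 0) - if x.1 = g z then 1 else 0 := by
    by_cases hw : w = z
    · subst hw
      rw [sub_self]
      exact Finset.sum_eq_zero fun y _ => by rw [if_neg y.2, mul_zero]
    · rw [Finset.sum_eq_single ⟨w, hw⟩]
      · simp [stdMatrix]
      · intro y _ hy
        rw [if_neg fun h => hy (Subtype.ext h), mul_zero]
      · simp
  ext x y
  rw [Matrix.mul_apply]
  have : ∀ w, stdMatrix z h w y = (if w.1 = h y.1 then 1 else 0) - if w.1 = h z then 1 else 0 :=
    fun _ => rfl
  simp only [this, mul_sub, Finset.sum_sub_distrib, key]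
  simp [stdMatrix]
  congr

/-- The diagonal expression vanishes at `y = z`, so the sum may run over all of `α`. -/
theorem trace_stdMatrix (g : Equiv.Perm α) :
    (stdMatrix z g).trace = (#{x | g x = x} : ℂ) - 1 := by
  have h1 : ∑ y : α, (((if y = g y then 1 else 0) - if y = g z then 1 else 0 : ℂ))
      = (#{x | g x = x} : ℂ) - 1 := by
    rw [Finset.sum_sub_distrib]
    simp [eq_comm]
  rw [← h1, ← Fintype.sum_subtype_add_sum_subtype (fun y => y ≠ z)]
  simp only [Matrix.trace, Matrix.diag, stdMatrix, Matrix.of_apply]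
  rw [left_eq_add]
  exact Finset.sum_eq_zero fun y _ => by
    have : y.1 = z := not_not.mp y.2
    rw [this, sub_self]

theorem det_one_add_X_smul_stdMatrix {g : Equiv.Perm α} (hg : g * g = 1) {s : ℕ}
    (hs : 2 * s + #{x | g x = x} = Fintype.card α) :
    det (1 + (X : ℂ[X]) • (stdMatrix z g).map C)
      = (1 + X) ^ (Fintype.card α - 1 - s) * (1 - X) ^ s := by
  have hpos : 0 < Fintype.card α := Fintype.card_pos_iff.mpr ⟨z⟩
  have hcard : Fintype.card {x // x ≠ z} = Fintype.card α - 1 := by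
    rw [Fintype.card_subtype_compl, Fintype.card_subtype_eq]
  have hA : stdMatrix z g * stdMatrix z g = 1 := by rw [stdMatrix_mul, hg, stdMatrix_one]
  refine det_one_add_X_smul_of_mul_self_eq_one hA (by omega) ?_
  have h : ((Fintype.card α - 1 - s : ℕ) : ℤ) - s = (#{x | g x = x} : ℤ) - 1 := by omega
  rw [trace_stdMatrix]
  exact_mod_cast h.symm

end StandardMatrix

/-! ### Specht modules of hooks -/

section Hook

open Matrix

/-- The tabloid whose row `r + 1` is `{b r}` and whose row `0` holds all other entries. -/
def pointTabloid {n i : ℕ} (b : Fin i → Fin n) : Tabloid n :=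
  fun x => ∑ r, if b r = x then (r : ℕ) + 1 else 0

theorem pointTabloid_apply {n i : ℕ} {b : Fin i → Fin n} (hb : b.Injective) (r : Fin i) :
    pointTabloid b (b r) = r + 1 := by
  simp [pointTabloid, hb.eq_iff]

theorem pointTabloid_of_forall_ne {n i : ℕ} {b : Fin i → Fin n} {x : Fin n} (hx : ∀ r, b r ≠ x) :
    pointTabloid b x = 0 :=
  Finset.sum_eq_zero fun r _ => if_neg (hx r)

theorem pointTabloid_inj {n i : ℕ} {b b' : Fin i → Fin n} (hb : b.Injective)
    (hb' : b'.Injective) : pointTabloid b = pointTabloid b' ↔ b = b' := by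
  refine ⟨fun h => funext fun r => ?_, fun h => h ▸ rfl⟩
  have h1 := congrFun h (b r)
  rw [pointTabloid_apply hb] at h1
  by_cases h2 : ∀ r', b' r' ≠ b r
  · rw [pointTabloid_of_forall_ne h2] at h1; omega
  · push Not at h2
    obtain ⟨r', hr'⟩ := h2
    rw [← hr', pointTabloid_apply hb'] at h1
    obtain rfl : r = r' := Fin.ext (by omega)
    exact hr'.symm

theorem mem_hook {n i : ℕ} (hi : i < n) {c : ℕ × ℕ} :
    c ∈ (hook n i hi).cells ↔ (c.1 = 0 ∧ c.2 < n - i) ∨ (0 < c.1 ∧ c.1 ≤ i ∧ c.2 = 0) := by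
  refine (YoungDiagram.mem_ofRowLens (hw := hook_sorted n i hi)).trans ?_
  obtain ⟨r, k⟩ := c
  rcases r with _ | r
  · simp
  · simp

theorem card_hook {n i : ℕ} (hi : i < n) : #(hook n i hi).cells = n := by
  have : (hook n i hi).cells = ({0} ×ˢ range (n - i)) ∪ (Finset.Ioc 0 i ×ˢ {0}) := by
    ext c
    simp only [mem_hook, mem_union, mem_product, mem_singleton, mem_range, Finset.mem_Ioc]
    tauto
  rw [this, card_union_of_disjoint]
  · simp; omega
  · rw [disjoint_left]
    intro c
    simp only [mem_product, mem_singleton, mem_range, Finset.mem_Ioc]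
    omega

/-- The cells of the first column of a hook. -/
def hookCell {n i : ℕ} (hi : i < n) (r : Fin (i + 1)) : {c // c ∈ (hook n i hi).cells} :=
  ⟨(r, 0), by
    rw [mem_hook]
    have := r.2
    rcases Nat.eq_zero_or_pos (r : ℕ) with h | h
    · exact Or.inl ⟨h, by simp; omega⟩
    · exact Or.inr ⟨h, by simp; omega, rfl⟩⟩

theorem hookCell_injective {n i : ℕ} (hi : i < n) : (hookCell hi).Injective := fun _ _ h =>
  Fin.ext (congrArg (fun c => c.1.1) h)

/-- The rows of a hook index the cells of its first column. -/
def hookColumn {n i : ℕ} (hi : i < n) :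
    Fin (i + 1) ≃ {c : {c // c ∈ (hook n i hi).cells} // c.1.2 = 0} :=
  Equiv.ofBijective (fun r => ⟨hookCell hi r, rfl⟩) <| by
    refine ⟨fun r r' h => hookCell_injective hi (congrArg Subtype.val h), fun c => ?_⟩
    have hc := (mem_hook hi).mp c.1.2
    have hc0 := c.2
    refine ⟨⟨c.1.1.1, by omega⟩, Subtype.ext (Subtype.ext (Prod.ext rfl ?_))⟩
    exact hc0.symm

variable {n i : ℕ} {hi : i < n}

theorem tabloid_eq_pointTabloid (T : Tableau n (hook n i hi)) :
    T.tabloid = pointTabloid fun r : Fin i => T (hookCell hi r.succ) := by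
  have hinj : Function.Injective fun r : Fin i => T (hookCell hi r.succ) :=
    T.injective.comp ((hookCell_injective hi).comp (Fin.succ_injective i))
  funext x
  obtain ⟨c, rfl⟩ := T.surjective x
  rw [Tableau.tabloid, T.symm_apply_apply]
  have hc := (mem_hook hi).mp c.2
  by_cases h0 : c.1.1 = 0
  · rw [h0, pointTabloid_of_forall_ne]
    intro r h
    have := congrArg (fun c => c.1.1) (T.injective h)
    simp [hookCell] at this
    omega
  · have : c = hookCell hi (Fin.succ ⟨c.1.1 - 1, by omega⟩) := by
      refine Subtype.ext (Prod.ext ?_ ?_)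
      · simp [hookCell]; omega
      · simp [hookCell]; omega
    have h := pointTabloid_apply hinj ⟨c.1.1 - 1, by omega⟩
    simp only at h
    rw [← this] at h
    rw [h]
    omega

/-- Only the first column of a hook can have more than one cell, so the column group is the
symmetric group of that column. -/
theorem polytabloid_hook (T : Tableau n (hook n i hi)) :
    polytabloid T = ∑ π : Equiv.Perm (Fin (i + 1)),
      Finsupp.single (pointTabloid fun r : Fin i => T (hookCell hi (π r.succ)))
        ((Equiv.Perm.sign π : ℤ) : ℂ) := by
  symm
  refine Finset.sum_bij (fun π _ => π.extendDomain (hookColumn hi)) ?_ ?_ ?_ ?_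
  · intro π _
    simp only [columnGroup, mem_filter, mem_univ, true_and]
    intro c
    by_cases hc : c.1.2 = 0
    · rw [π.extendDomain_apply_subtype (p := fun c : {c // c ∈ (hook n i hi).cells} => c.1.2 = 0)
        (hookColumn hi) hc, hc]
      exact (hookColumn hi (π ((hookColumn hi).symm ⟨c, hc⟩))).2
    · rw [π.extendDomain_apply_not_subtype
        (p := fun c : {c // c ∈ (hook n i hi).cells} => c.1.2 = 0) (hookColumn hi) hc]
  · intro π _ π' _ h
    exact Equiv.Perm.extendDomainHom_injective (hookColumn hi) h
  · intro σ hσ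
    simp only [columnGroup, mem_filter, mem_univ, true_and] at hσ
    refine ⟨(hookColumn hi).symm.permCongr
      (σ.subtypePerm (p := fun c => c.1.2 = 0) fun c => by rw [hσ]), mem_univ _, ?_⟩
    ext1 c
    by_cases hc : c.1.2 = 0
    · rw [Equiv.Perm.extendDomain_apply_subtype
        (p := fun c : {c // c ∈ (hook n i hi).cells} => c.1.2 = 0) _ (hookColumn hi) hc]
      simp [Equiv.permCongr_apply]
    · rw [Equiv.Perm.extendDomain_apply_not_subtype
        (p := fun c : {c // c ∈ (hook n i hi).cells} => c.1.2 = 0) _ (hookColumn hi) hc]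
      refine Subtype.ext (Prod.ext ?_ (hσ c).symm)
      have h1 := (mem_hook hi).mp c.2
      have h2 := (mem_hook hi).mp (σ c).2
      have h3 := hσ c
      omega
  · intro π _
    rw [Equiv.Perm.sign_extendDomain, tabloid_eq_pointTabloid]
    congr 2
    funext r
    have : π.extendDomain (hookColumn hi) (hookCell hi r.succ) = hookCell hi (π r.succ) := 
      Equiv.Perm.extendDomain_apply_image π (hookColumn hi) r.succ
    simp [this]

/-! ### Coefficients of hook polytabloids as determinants -/

/-- The matrix whose determinant is the coefficient of `pointTabloid b` in the polytabloid of a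
hook tableau with first column `a`. -/
def pairing (a : Fin (i + 1) → Fin n) (b : Fin i → Fin n) :
    Matrix (Fin (i + 1)) (Fin (i + 1)) ℂ :=
  Matrix.of fun c r => Fin.cases 1 (fun r => if a c = b r then 1 else 0) r

/-- This is the Leibniz expansion: the column of ones puts no condition on the entry moved to row
`0`. -/
theorem polytabloid_hook_apply (T : Tableau n (hook n i hi)) {b : Fin i → Fin n}
    (hb : b.Injective) :
    polytabloid T (pointTabloid b) = (pairing (fun c => T (hookCell hi c)) b).det := by
  rw [polytabloid_hook, Finsupp.finsetSum_apply, det_apply]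
  refine Finset.sum_congr rfl fun π _ => ?_
  have hinj : Function.Injective fun r : Fin i => T (hookCell hi (π r.succ)) :=
    T.injective.comp ((hookCell_injective hi).comp (π.injective.comp (Fin.succ_injective i)))
  simp only [Finsupp.single_apply, pointTabloid_inj hinj hb, Fin.prod_univ_succ]
  simp only [pairing, of_apply, Fin.cases_zero, Fin.cases_succ, one_mul]
  rw [Finset.prod_boole]
  simp [funext_iff, Units.smul_def]

theorem det_pairing_comp_perm (a : Fin (i + 1) → Fin n) (b : Fin i → Fin n)
    (σ : Equiv.Perm (Fin i)) :
    (pairing a (b ∘ σ)).det = ((Equiv.Perm.sign σ : ℤ) : ℂ) * (pairing a b).det := by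
  have : pairing a (b ∘ σ) =
      (pairing a b).submatrix id (Equiv.Perm.decomposeFin.symm ((0 : Fin (i + 1)), σ)) := by
    ext c r
    refine Fin.cases ?_ (fun r => ?_) r
    · simp [pairing]
    · simp [pairing]
  rw [this, det_permute', Equiv.Perm.decomposeFin.symm_sign]
  simp

theorem det_pairing_of_not_injective (a : Fin (i + 1) → Fin n) {b : Fin i → Fin n}
    (hb : ¬ b.Injective) : (pairing a b).det = 0 := by
  rw [Function.Injective] at hb
  push Not at hb
  obtain ⟨r, r', h, hne⟩ := hb
  refine det_zero_of_column_eq (i := r.succ) (j := r'.succ) (by simpa using hne) fun c => ?_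
  simp [pairing, h]

/-- Summing over `x` turns column `r.succ` into a column of ones, which repeats column `0`. -/
theorem sum_det_pairing_update (a : Fin (i + 1) → Fin n) (b : Fin i → Fin n) (r : Fin i) :
    ∑ x, (pairing a (Function.update b r x)).det = 0 := by
  have h (x : Fin n) : (pairing a (Function.update b r x)).det
      = (pairing a b).cramer (fun c => if a c = x then 1 else 0) r.succ := by
    rw [cramer_apply]
    congr 1
    ext c k
    refine Fin.cases ?_ (fun k => ?_) k
    · simp [pairing, (Fin.succ_ne_zero r).symm]
    · by_cases hk : k = r
      · subst hk; simp [pairing]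
      · simp [pairing, hk]
  simp only [h]
  rw [← Finset.sum_apply, ← map_sum, cramer_apply]
  refine det_zero_of_column_eq (i := 0) (j := r.succ) (Fin.succ_ne_zero r).symm fun c => ?_
  simp [pairing, (Fin.succ_ne_zero r).symm]

/-- Subtracting row `0` from the other rows clears the column of ones below its top entry; the
remaining block is a transposed minor of `stdMatrix`. -/
theorem det_pairing_cons {z : Fin n} (g : Equiv.Perm (Fin n)) (a b : Fin i → {x // x ≠ z}) :
    (pairing (fun c => g (Fin.cons (α := fun _ => Fin n) z (fun r => (a r).1) c))
      (fun r => (b r).1)).det = ((stdMatrix z g).submatrix b a).det := by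
  set M := pairing (fun c => g (Fin.cons (α := fun _ => Fin n) z (fun r => (a r).1) c))
      (fun r => (b r).1) with hM
  let B : Matrix (Fin (i + 1)) (Fin (i + 1)) ℂ :=
    Matrix.of fun c r => Fin.cases (M 0 r) (fun c => M c.succ r - M 0 r) c
  have hMB : M.det = B.det := by
    refine det_eq_of_forall_row_eq_smul_add_const (Fin.cases 0 fun _ => 1) 0 rfl fun c r => ?_
    refine Fin.cases ?_ (fun c => ?_) c
    · simp [B]
    · simp [B]
  rw [hMB, det_succ_column_zero, Finset.sum_eq_single 0]
  · rw [← det_transpose]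
    have h0 : B 0 0 = 1 := by simp [B, hM, pairing]
    rw [h0]
    simp only [Fin.val_zero, pow_zero, one_mul]
    congr 1
    ext r c
    simp [B, hM, pairing, stdMatrix, Fin.succAbove_zero, eq_comm]
  · intro c _ hc
    obtain ⟨c, rfl⟩ := Fin.exists_succ_eq.mpr hc
    have : B c.succ 0 = 0 := by simp [B, hM, pairing]
    rw [this]; simp
  · simp

theorem exists_tableau_hook (hi : i < n) {a : Fin (i + 1) → Fin n} (ha : a.Injective) :
    ∃ T : Tableau n (hook n i hi), ∀ c, T (hookCell hi c) = a c := by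
  let T₀ : Tableau n (hook n i hi) := Fintype.equivFinOfCardEq (by
    rw [Fintype.card_coe, card_hook])
  -- Multiple transitivity of the symmetric group moves the first column of an arbitrary tableau to
  -- `a`.
  obtain ⟨g, hg⟩ := (Equiv.Perm.isMultiplyPretransitive (Fin n) (i + 1)).exists_smul_eq
    ⟨fun c => T₀ (hookCell hi c), T₀.injective.comp (hookCell_injective hi)⟩ ⟨a, ha⟩
  exact ⟨T₀.trans g, fun c => congrArg (fun f => f c) hg⟩

theorem apply_eq_zero_of_mem_specht {w : Tabloid n →₀ ℂ}
    (hw : w ∈ (specht n (hook n i hi)).toSubmodule) {t : Tabloid n}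
    (ht : ∀ b : Fin i → Fin n, b.Injective → t ≠ pointTabloid b) : w t = 0 := by
  induction hw using Submodule.span_induction with
  | mem w hw =>
    obtain ⟨T, rfl⟩ := hw
    change polytabloid T t = 0
    rw [polytabloid_hook, Finsupp.finsetSum_apply]
    refine Finset.sum_eq_zero fun π _ => ?_
    exact Finsupp.single_eq_of_ne (ht _ (T.injective.comp ((hookCell_injective hi).comp
      (π.injective.comp (Fin.succ_injective i)))))
  | zero => rfl
  | add v w _ _ hv hw => rw [Finsupp.add_apply, hv, hw, add_zero]
  | smul a v _ hv => rw [Finsupp.smul_apply, hv, smul_zero]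

/-- The coefficient of `pointTabloid b`, extended by zero to tuples with repeated entries. -/
def coeffAt (w : Tabloid n →₀ ℂ) (b : Fin i → Fin n) : ℂ :=
  open Classical in if b.Injective then w (pointTabloid b) else 0

theorem coeffAt_polytabloid (T : Tableau n (hook n i hi)) (b : Fin i → Fin n) :
    coeffAt (polytabloid T) b = (pairing (fun c => T (hookCell hi c)) b).det := by
  by_cases hb : b.Injective
  · rw [coeffAt, if_pos hb, polytabloid_hook_apply T hb]
  · rw [coeffAt, if_neg hb, det_pairing_of_not_injective _ hb]

theorem coeffAt_add (v w : Tabloid n →₀ ℂ) (b : Fin i → Fin n) :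
    coeffAt (v + w) b = coeffAt v b + coeffAt w b := by
  simp only [coeffAt]; split_ifs <;> simp

theorem coeffAt_smul (a : ℂ) (w : Tabloid n →₀ ℂ) (b : Fin i → Fin n) :
    coeffAt (a • w) b = a * coeffAt w b := by
  simp only [coeffAt]; split_ifs <;> simp

theorem coeffAt_zero (b : Fin i → Fin n) : coeffAt (0 : Tabloid n →₀ ℂ) b = 0 := by
  simp [coeffAt]

theorem coeffAt_comp_perm {w : Tabloid n →₀ ℂ}
    (hw : w ∈ (specht n (hook n i hi)).toSubmodule) (b : Fin i → Fin n)
    (σ : Equiv.Perm (Fin i)) :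
    coeffAt w (b ∘ σ) = ((Equiv.Perm.sign σ : ℤ) : ℂ) * coeffAt w b := by
  induction hw using Submodule.span_induction with
  | mem w hw =>
    obtain ⟨T, rfl⟩ := hw
    rw [coeffAt_polytabloid, coeffAt_polytabloid, det_pairing_comp_perm]
  | zero => simp [coeffAt_zero]
  | add v w _ _ hv hw => rw [coeffAt_add, coeffAt_add, hv, hw, mul_add]
  | smul a v _ hv => rw [coeffAt_smul, coeffAt_smul, hv, mul_left_comm]

theorem sum_coeffAt_update {w : Tabloid n →₀ ℂ}
    (hw : w ∈ (specht n (hook n i hi)).toSubmodule) (b : Fin i → Fin n) (r : Fin i) :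
    ∑ x, coeffAt w (Function.update b r x) = 0 := by
  induction hw using Submodule.span_induction with
  | mem w hw =>
    obtain ⟨T, rfl⟩ := hw
    simp only [coeffAt_polytabloid, sum_det_pairing_update]
  | zero => simp [coeffAt_zero]
  | add v w _ _ hv hw => simp only [coeffAt_add, Finset.sum_add_distrib, hv, hw, add_zero]
  | smul a v _ hv => simp only [coeffAt_smul, ← Finset.mul_sum, hv, mul_zero]

/-- An enumeration of a finite set of `i` elements different from `z`. -/
def enum {z : Fin n} (s : {s : Finset {x : Fin n // x ≠ z} // #s = i}) (r : Fin i) :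
    {x : Fin n // x ≠ z} :=
  ((s.1.equivFinOfCardEq s.2).symm r).1

theorem enum_injective {z : Fin n} (s : {s : Finset {x : Fin n // x ≠ z} // #s = i}) :
    (enum s).Injective :=
  Subtype.val_injective.comp (Equiv.injective _)

theorem enum_val_injective {z : Fin n} (s : {s : Finset {x : Fin n // x ≠ z} // #s = i}) :
    Function.Injective fun r => (enum s r).1 :=
  Subtype.val_injective.comp (enum_injective s)

theorem enum_mem {z : Fin n} (s : {s : Finset {x : Fin n // x ≠ z} // #s = i}) (r : Fin i) :
    enum s r ∈ s.1 :=
  Subtype.prop _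

theorem exists_enum_eq {z : Fin n} (s : {s : Finset {x : Fin n // x ≠ z} // #s = i})
    {x : {x : Fin n // x ≠ z}} (hx : x ∈ s.1) : ∃ r, enum s r = x :=
  ⟨s.1.equivFinOfCardEq s.2 ⟨x, hx⟩, by simp [enum]⟩

theorem exists_eq_enum_comp {z : Fin n} {b : Fin i → {x : Fin n // x ≠ z}} (hb : b.Injective) :
    ∃ (s : {s : Finset {x : Fin n // x ≠ z} // #s = i}) (σ : Equiv.Perm (Fin i)),
      b = enum s ∘ σ := by
  let s : {s : Finset {x : Fin n // x ≠ z} // #s = i} :=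
    ⟨univ.image b, by rw [card_image_of_injective _ hb]; simp⟩
  have hs (r : Fin i) : ∃ k, enum s k = b r :=
    exists_enum_eq s (mem_image_of_mem b (mem_univ r))
  choose σ hσ using hs
  have hσi : σ.Injective := fun r r' h => hb (by rw [← hσ, ← hσ, h])
  exact ⟨s, Equiv.ofBijective σ (Finite.injective_iff_bijective.mp hσi),
    funext fun r => (hσ r).symm⟩

/-- Alternation handles all tuples avoiding `z`. If `z` sits in slot `r`, the zero-sum relation in
that slot expresses the coefficient through tuples avoiding `z`. -/
theorem eq_zero_of_mem_specht (z : Fin n) {w : Tabloid n →₀ ℂ}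
    (hw : w ∈ (specht n (hook n i hi)).toSubmodule)
    (h : ∀ s : {s : Finset {x : Fin n // x ≠ z} // #s = i},
      w (pointTabloid fun r => (enum s r).1) = 0) : w = 0 := by
  have h1 (b : Fin i → Fin n) (hb : ∀ r, b r ≠ z) : coeffAt w b = 0 := by
    by_cases hinj : b.Injective
    · obtain ⟨s, σ, hs⟩ := exists_eq_enum_comp (b := fun r => (⟨b r, hb r⟩ : {x // x ≠ z}))
        fun r r' h => hinj (congrArg Subtype.val h)
      have : b = (fun r => (enum s r).1) ∘ σ :=
        funext fun r => congrArg Subtype.val (congrFun hs r)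
      rw [this, coeffAt_comp_perm hw, coeffAt, if_pos (enum_val_injective s), h s, mul_zero]
    · rw [coeffAt, if_neg hinj]
  have h2 (b : Fin i → Fin n) (hinj : b.Injective) : coeffAt w b = 0 := by
    by_cases hb : ∀ r, b r ≠ z
    · exact h1 b hb
    · push Not at hb
      obtain ⟨r, hr⟩ := hb
      have := sum_coeffAt_update hw b r
      rw [Finset.sum_eq_single z] at this
      · rwa [← hr, Function.update_eq_self] at this
      · intro x _ hx
        refine h1 _ fun k => ?_
        by_cases hk : k = r
        · subst hk; simpa using hx
        · rw [Function.update_of_ne hk, ← hr]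
          exact hinj.ne hk
      · simp
  ext t
  by_cases ht : ∀ b : Fin i → Fin n, b.Injective → t ≠ pointTabloid b
  · exact apply_eq_zero_of_mem_specht hw ht
  · push Not at ht
    obtain ⟨b, hb, rfl⟩ := ht
    have := h2 b hb
    rwa [coeffAt, if_pos hb] at this

/-! ### The basis of a hook Specht module, its dimension and its character -/

/-- The coordinates of an element of a hook Specht module. -/
def spechtCoord (hi : i < n) (z : Fin n) :
    (specht n (hook n i hi)).toSubmodule →ₗ[ℂ]
      ({s : Finset {x : Fin n // x ≠ z} // #s = i} → ℂ) where
  toFun w s := w.1 (pointTabloid fun r => (enum s r).1)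
  map_add' _ _ := rfl
  map_smul' _ _ := rfl

/-- The vector is the polytabloid with first column `z` followed by `s`. Taking `g = 1` shows that
these vectors are dual to the coordinates; general `g` gives the matrix of the action, whose entries
are the `i × i` minors. -/
theorem exists_specht_basis (hi : i < n) (z : Fin n)
    (s : {s : Finset {x : Fin n // x ≠ z} // #s = i}) :
    ∃ v : (specht n (hook n i hi)).toSubmodule, ∀ g s',
      spechtCoord hi z ((specht n (hook n i hi)).toRepresentation g v) s' =
        ((stdMatrix z g).submatrix (enum s') (enum s)).det := by
  have ha : Function.Injective (Fin.cons (α := fun _ => Fin n) z fun r => (enum s r).1) := by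
    rw [Fin.cons_injective_iff]
    refine ⟨?_, enum_val_injective s⟩
    rintro ⟨r, hr⟩
    exact (enum s r).2 hr
  obtain ⟨T, hT⟩ := exists_tableau_hook hi ha
  refine ⟨⟨polytabloid T, Submodule.subset_span ⟨T, rfl⟩⟩, fun g s' => ?_⟩
  have : spechtCoord hi z ((specht n (hook n i hi)).toRepresentation g
      ⟨polytabloid T, Submodule.subset_span ⟨T, rfl⟩⟩) s' =
      tabloidRep n g (polytabloid T) (pointTabloid fun r => (enum s' r).1) := rfl
  rw [this, tabloidRep_polytabloid, polytabloid_hook_apply _ (enum_val_injective s'),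
    ← det_pairing_cons]
  simp [hT]

theorem det_submatrix_enum_one {z : Fin n} (s s' : {s : Finset {x : Fin n // x ≠ z} // #s = i}) :
    ((1 : Matrix {x // x ≠ z} {x // x ≠ z} ℂ).submatrix (enum s') (enum s)).det
      = if s = s' then 1 else 0 := by
  split_ifs with h
  · subst h
    rw [submatrix_one _ (enum_injective s), det_one]
  · have : ∃ r, enum s' r ∉ s.1 := by
      by_contra! hs
      refine h (Subtype.ext (Finset.eq_of_subset_of_card_le (fun x hx => ?_)
        (by rw [s.2, s'.2])).symm)
      obtain ⟨r, rfl⟩ := exists_enum_eq s' hx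
      exact hs r
    obtain ⟨r, hr⟩ := this
    refine det_eq_zero_of_row_eq_zero r fun c => ?_
    rw [submatrix_apply, one_apply_ne]
    exact fun h => hr (h ▸ enum_mem s c)

/-- The basis of a hook Specht module dual to the coefficients of the tabloids that have a fixed
entry `z` in their first row. -/
def spechtEquiv (hi : i < n) (z : Fin n) :
    (specht n (hook n i hi)).toSubmodule ≃ₗ[ℂ]
      ({s : Finset {x : Fin n // x ≠ z} // #s = i} → ℂ) :=
  LinearEquiv.ofBijective (spechtCoord hi z) <| by
    constructor
    · refine (injective_iff_map_eq_zero _).mpr ?_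
      exact fun w hw => Subtype.ext (eq_zero_of_mem_specht z w.2 fun s => congrFun hw s)
    · rw [← LinearMap.range_eq_top, eq_top_iff, ← (Pi.basisFun ℂ _).span_eq, Submodule.span_le]
      rintro _ ⟨s, rfl⟩
      obtain ⟨v, hv⟩ := exists_specht_basis hi z s
      refine ⟨v, funext fun s' => ?_⟩
      have := hv 1 s'
      rw [map_one, Module.End.one_apply, stdMatrix_one, det_submatrix_enum_one] at this
      rw [this, Pi.basisFun_apply, Pi.single_apply]
      simp [eq_comm]

theorem dimSpecht_hook (hi : i < n) : dimSpecht n (hook n i hi) = (n - 1).choose i := by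
  have z : Fin n := ⟨i, hi⟩
  rw [dimSpecht, (spechtEquiv hi z).finrank_eq, Module.finrank_fintype_fun_eq_card,
    Fintype.card_finset_len, Fintype.card_subtype_compl, Fintype.card_subtype_eq, Fintype.card_fin]

/-- The diagonal entries of the action are the principal `i × i` minors, and their sum is the stated
coefficient. -/
theorem chi_hook (hi : i < n) (z : Fin n) (g : Equiv.Perm (Fin n)) :
    chi n (hook n i hi) g =
      (det (1 + (Polynomial.X : Polynomial ℂ) • (stdMatrix z g).map Polynomial.C)).coeff i := by
  rw [coeff_det_one_add_X_smul_eq_sum_minors, chi,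
    LinearMap.trace_eq_matrix_trace ℂ (Module.Basis.ofEquivFun (spechtEquiv hi z)), Matrix.trace]
  rw [Finset.sum_subtype (F := inferInstance) (p := fun s => #s = i) (powersetCard i univ)
    (by simp [mem_powersetCard])]
  refine Finset.sum_congr rfl fun s _ => ?_
  obtain ⟨v, hv⟩ := exists_specht_basis hi z s
  have hvs : Module.Basis.ofEquivFun (spechtEquiv hi z) s = v := by
    rw [Module.Basis.coe_ofEquivFun, LinearEquiv.symm_apply_eq]
    funext s'
    have := hv 1 s'
    rw [map_one, Module.End.one_apply, stdMatrix_one, det_submatrix_enum_one] at this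
    refine Eq.trans ?_ this.symm
    rw [Pi.single_apply]
    simp [eq_comm]
  rw [diag_apply, LinearMap.toMatrix_apply, hvs, Module.Basis.ofEquivFun_repr_apply]
  refine (hv g s).trans ?_
  rw [← det_submatrix_equiv_self (s.1.equivFinOfCardEq s.2).symm]
  rfl

end Hook

/-! ### The step distribution -/

section Step

open Polynomial

variable {n : ℕ}

theorem two_mul_card_cycleFactorsFinset {α : Type*} [Fintype α] [DecidableEq α]
    {g : Equiv.Perm α} (hg : g * g = 1) :
    2 * #g.cycleFactorsFinset + #{x | g x = x} = Fintype.card α := by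
  have h2 : ∀ c ∈ g.cycleType, c = 2 :=
    Equiv.Perm.pow_prime_eq_one_iff.mp (by rw [pow_two, hg])
  have h3 : g.cycleType = Multiset.replicate #g.cycleFactorsFinset 2 := by
    rw [Multiset.eq_replicate]
    exact ⟨by rw [Equiv.Perm.cycleType_def, Multiset.card_map, Finset.card_def], h2⟩
  have h4 := g.sum_cycleType
  rw [h3, Multiset.sum_replicate, smul_eq_mul] at h4
  have h5 := Finset.card_filter_add_card_filter_not (s := univ) (fun x => g x = x)
  rw [Finset.card_univ] at h5
  have h6 : g.support = univ.filter fun x => ¬ g x = x := by ext x; simp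
  rw [h6] at h4
  omega

/-- On its support, which it preserves, `g` agrees with `τ`. -/
theorem mul_self_eq_one_of_cycleFactorsFinset_subset {α : Type*} [Fintype α] [DecidableEq α]
    {g τ : Equiv.Perm α} (hτ : τ * τ = 1) (hg : g.cycleFactorsFinset ⊆ τ.cycleFactorsFinset) :
    g * g = 1 := by
  have h {x : α} (hx : x ∈ g.support) : g x = τ x := by
    have h1 := hg (Equiv.Perm.cycleOf_mem_cycleFactorsFinset_iff.mpr hx)
    have h2 := (Equiv.Perm.mem_cycleFactorsFinset_iff.mp h1).2 x
      (by rw [Equiv.Perm.mem_support, Equiv.Perm.cycleOf_apply_self]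
          exact Equiv.Perm.mem_support.mp hx)
    rwa [Equiv.Perm.cycleOf_apply_self] at h2
  ext x
  by_cases hx : x ∈ g.support
  · rw [Equiv.Perm.mul_apply, h (Equiv.Perm.apply_mem_support.mpr hx), h hx,
      ← Equiv.Perm.mul_apply, hτ]
  · rw [Equiv.Perm.notMem_support] at hx
    rw [Equiv.Perm.mul_apply, hx, hx, Equiv.Perm.one_apply]

/-- A set of cycles of `τ` is pairwise disjoint, so it is the cycle set of exactly one permutation,
its product. -/
theorem sum_perm_cycleFactorsFinset_subset {α : Type*} [Fintype α] [DecidableEq α]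
    (τ : Equiv.Perm α) (f : Finset (Equiv.Perm α) → ℂ) :
    (∑ g : Equiv.Perm α, if g.cycleFactorsFinset ⊆ τ.cycleFactorsFinset
      then f g.cycleFactorsFinset else 0) = ∑ S ∈ τ.cycleFactorsFinset.powerset, f S := by
  rw [← Finset.sum_filter]
  refine Finset.sum_bij (fun g _ => g.cycleFactorsFinset) ?_ ?_ ?_ ?_
  · intro g hg
    simpa using hg
  · intro g _ g' _ h
    exact Equiv.Perm.cycleFactorsFinset_injective h
  · intro S hS
    rw [mem_powerset] at hS
    have hd : (S : Set (Equiv.Perm α)).Pairwise Equiv.Perm.Disjoint :=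
      τ.cycleFactorsFinset_pairwise_disjoint.mono hS
    have h : (S.noncommProd id fun _ ha _ hb hab => (hd ha hb hab).commute).cycleFactorsFinset
        = S := Equiv.Perm.cycleFactorsFinset_eq_finset.mpr
      ⟨fun f hf => (Equiv.Perm.mem_cycleFactorsFinset_iff.mp (hS hf)).1, hd, rfl⟩
    exact ⟨_, by simpa [h] using hS, h⟩
  · intro g _
    rfl

theorem matchings_nonempty (hn : Even n) : (matchings n).Nonempty := by
  -- Order reversal could only fix a middle element, and there is none for even `n`.
  refine ⟨Fin.revPerm, ?_⟩
  simp only [matchings, mem_filter, mem_univ, true_and]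
  refine ⟨by ext; simp, fun x h => ?_⟩
  have := congrArg Fin.val h
  simp only [Fin.revPerm_apply, Fin.val_rev] at this
  obtain ⟨k, rfl⟩ := hn
  omega

/-- The generating function of the values of the hook characters at `g`. -/
theorem chi_hook_of_mul_self_eq_one {i : ℕ} (hi : i < n) {g : Equiv.Perm (Fin n)}
    (hg : g * g = 1) :
    chi n (hook n i hi) g = ((1 + X : ℂ[X]) ^ (n - 1 - #g.cycleFactorsFinset) *
      (1 - X) ^ #g.cycleFactorsFinset).coeff i := by
  rw [chi_hook hi ⟨i, hi⟩, det_one_add_X_smul_stdMatrix _ hg (two_mul_card_cycleFactorsFinset hg),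
    Fintype.card_fin]

theorem sum_matching_chi_hook {m i : ℕ} (hi : i < 2 * m) (p : ℂ) {τ : Equiv.Perm (Fin (2 * m))}
    (hτ : τ ∈ matchings (2 * m)) :
    (∑ g : Equiv.Perm (Fin (2 * m)), if g.cycleFactorsFinset ⊆ τ.cycleFactorsFinset then
        p ^ #(τ.cycleFactorsFinset \ g.cycleFactorsFinset) * (1 - p) ^ #g.cycleFactorsFinset *
          chi (2 * m) (hook (2 * m) i hi) g
      else 0) =
      ((1 + (C (2 * p) * X + C (2 * p - 1) * X ^ 2)) ^ (m - 1) *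
        (1 + C (2 * p - 1) * X)).coeff i := by
  simp only [matchings, mem_filter, mem_univ, true_and] at hτ
  have hcard : #τ.cycleFactorsFinset = m := by
    have h := two_mul_card_cycleFactorsFinset hτ.1
    rw [Finset.filter_false_of_mem fun x _ => hτ.2 x, card_empty, Fintype.card_fin] at h
    omega
  obtain ⟨m, rfl⟩ : ∃ k, m = k + 1 := ⟨m - 1, by omega⟩
  let F (s : ℕ) : ℂ[X] := (C (1 - p) * (1 - X)) ^ s * (C p * (1 + X)) ^ (m + 1 - s)
  -- Splitting off `(1 + X) ^ m`, independent of `s`, leaves exactly a term of a binomial expansion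
  -- of degree `m + 1`.
  have hF {s : ℕ} (hs : s ≤ m + 1) : C (p ^ (m + 1 - s) * (1 - p) ^ s) *
      ((1 + X) ^ (2 * (m + 1) - 1 - s) * (1 - X) ^ s) = (1 + X) ^ m * F s := by
    have : 2 * (m + 1) - 1 - s = m + (m + 1 - s) := by omega
    simp only [F]
    rw [this, mul_pow, mul_pow, C_mul, C_pow, C_pow, pow_add]
    ring
  have hterm (g : Equiv.Perm (Fin (2 * (m + 1)))) :
      (if g.cycleFactorsFinset ⊆ τ.cycleFactorsFinset then
        p ^ #(τ.cycleFactorsFinset \ g.cycleFactorsFinset) * (1 - p) ^ #g.cycleFactorsFinset *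
          chi (2 * (m + 1)) (hook (2 * (m + 1)) i hi) g
      else 0) = if g.cycleFactorsFinset ⊆ τ.cycleFactorsFinset then
        ((1 + X) ^ m * F #g.cycleFactorsFinset).coeff i else 0 := by
    split_ifs with h
    · have hle := card_le_card h
      rw [hcard] at hle
      rw [chi_hook_of_mul_self_eq_one hi (mul_self_eq_one_of_cycleFactorsFinset_subset hτ.1 h),
        card_sdiff_of_subset h, hcard, ← coeff_C_mul, hF hle]
    · rfl
  have hbinom := sum_pow_mul_eq_add_pow (C (1 - p) * (1 - X)) (C p * (1 + X))
    τ.cycleFactorsFinset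
  rw [hcard] at hbinom
  have hsum := sum_perm_cycleFactorsFinset_subset τ fun S => ((1 + X) ^ m * F #S).coeff i
  have hgoal : (∑ g : Equiv.Perm (Fin (2 * (m + 1))),
      if g.cycleFactorsFinset ⊆ τ.cycleFactorsFinset then
        ((1 + X) ^ m * F #g.cycleFactorsFinset).coeff i else 0) =
      ∑ S ∈ τ.cycleFactorsFinset.powerset, ((1 + X) ^ m * F #S).coeff i := by
    convert hsum
  rw [sum_congr rfl fun g _ => hterm g, hgoal, ← finsetSum_coeff, ← mul_sum, hbinom, Nat.add_sub_cancel]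
  congr 1
  simp only [C_sub, C_mul, C_1, map_ofNat]
  have h1 : (1 - C p) * (1 - X) + C p * (1 + X) = 1 + (2 * C p - 1) * X := by ring
  have h2 : 1 + (2 * C p * X + (2 * C p - 1) * X ^ 2) = (1 + X) * (1 + (2 * C p - 1) * X) := by
    ring
  rw [h1, h2, mul_pow, pow_succ]
  ring

theorem psi_hook {m i : ℕ} (hi : i < 2 * m) (p : ℝ) :
    psi (2 * m) p (hook (2 * m) i hi) =
      ((1 + (C (2 * p : ℂ) * X + C (2 * p - 1 : ℂ) * X ^ 2)) ^ (m - 1) *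
        (1 + C (2 * p - 1 : ℂ) * X)).coeff i / ((2 * m - 1).choose i : ℂ) := by
  have hM : (#(matchings (2 * m)) : ℂ) ≠ 0 := by
    exact_mod_cast (card_pos.mpr (matchings_nonempty (even_two_mul m))).ne'
  rw [psi, dimSpecht_hook]
  have h (g : Equiv.Perm (Fin (2 * m))) :
      (step (2 * m) p g : ℂ) * (chi (2 * m) (hook (2 * m) i hi) g / ((2 * m - 1).choose i : ℂ)) =
      (∑ τ ∈ matchings (2 * m), if g.cycleFactorsFinset ⊆ τ.cycleFactorsFinset then
        (p : ℂ) ^ #(τ.cycleFactorsFinset \ g.cycleFactorsFinset) *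
          (1 - (p : ℂ)) ^ #g.cycleFactorsFinset * chi (2 * m) (hook (2 * m) i hi) g
      else 0) / #(matchings (2 * m)) / ((2 * m - 1).choose i : ℂ) := by
    rw [step, Complex.ofReal_div, Complex.ofReal_sum, ← mul_div_assoc, div_mul_eq_mul_div, sum_mul]
    congr 2
    refine sum_congr rfl fun τ _ => ?_
    split_ifs <;> simp
  rw [sum_congr rfl fun g _ => h g, ← sum_div, ← sum_div, sum_comm,
    sum_congr rfl fun τ hτ => sum_matching_chi_hook hi p hτ, sum_const, nsmul_eq_mul,
    mul_div_cancel_left₀ _ hM]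

/-! ### Powers of a trinomial -/

theorem trinomial_eq_choose_mul_choose {N j q r : ℕ} (h : j + q + r = N) :
    trinomial N j q r = N.choose j * (N - j).choose q := by
  rw [trinomial, if_pos h]
  refine Nat.div_eq_of_eq_mul_left (by positivity) ?_
  have h1 := Nat.choose_mul_factorial_mul_factorial (show j ≤ N by omega)
  have h2 := Nat.choose_mul_factorial_mul_factorial (show q ≤ N - j by omega)
  have h3 : N - j - q = r := by omega
  rw [h3] at h2
  rw [← h1, ← h2]
  ring

theorem coeff_one_add_C_mul_X_sq_pow (b : ℂ) (M l : ℕ) :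
    ((1 + C b * X ^ 2 : ℂ[X]) ^ M).coeff l =
      if Even l then (M.choose (l / 2) : ℂ) * b ^ (l / 2) else 0 := by
  have h : (1 + C b * X ^ 2 : ℂ[X]) ^ M = expand ℂ 2 (((1 + X) ^ M).comp (C b * X)) := by
    simp
  rw [h, coeff_expand two_pos, comp_C_mul_X_coeff, coeff_one_add_X_pow]
  simp only [even_iff_two_dvd]

theorem coeff_trinomial_pow (a b : ℂ) (N k : ℕ) :
    ((1 + (C a * X + C b * X ^ 2) : ℂ[X]) ^ N).coeff k =
      ∑ j ∈ (range (k + 1)).filter (fun j => Even (k - j) ∧ k + j ≤ 2 * N),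
        (trinomial N j ((k - j) / 2) ((2 * N - k - j) / 2) : ℂ) * a ^ j * b ^ ((k - j) / 2) := by
  have h : (1 + (C a * X + C b * X ^ 2) : ℂ[X]) ^ N =
      ∑ j ∈ range (N + 1), C (a ^ j * N.choose j) * ((1 + C b * X ^ 2) ^ (N - j) * X ^ j) := by
    rw [show (1 + (C a * X + C b * X ^ 2) : ℂ[X]) = C a * X + (1 + C b * X ^ 2) by ring, add_pow]
    refine sum_congr rfl fun j _ => ?_
    rw [mul_pow, C_mul, C_pow, C_eq_natCast]
    ring
  have hset : (range (k + 1)).filter (fun j => Even (k - j) ∧ k + j ≤ 2 * N) =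
      (range (N + 1)).filter (fun j => j ≤ k ∧ Even (k - j) ∧ k + j ≤ 2 * N) := by
    ext j
    simp only [mem_filter, mem_range]
    constructor
    · rintro ⟨h1, h2, h3⟩; exact ⟨by omega, by omega, h2, h3⟩
    · rintro ⟨_, h1, h2, h3⟩; exact ⟨by omega, h2, h3⟩
  rw [h, finsetSum_coeff, hset, sum_filter]
  refine sum_congr rfl fun j hj => ?_
  rw [mem_range] at hj
  rw [coeff_C_mul, coeff_mul_X_pow', coeff_one_add_C_mul_X_sq_pow]
  by_cases h1 : j ≤ k
  swap
  · simp [h1]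
  by_cases h2 : Even (k - j)
  swap
  · simp [h2]
  obtain ⟨q, hq⟩ := h2
  by_cases h3 : k + j ≤ 2 * N
  · rw [if_pos h1, if_pos ⟨q, hq⟩, if_pos ⟨h1, ⟨q, hq⟩, h3⟩,
      trinomial_eq_choose_mul_choose (by omega), Nat.cast_mul]
    ring
  -- Here the third lower entry would be negative, and the binomial coefficient is zero.
  · rw [if_pos h1, if_pos ⟨q, hq⟩, if_neg (fun h => h3 h.2.2),
      Nat.choose_eq_zero_of_lt (by omega : N - j < (k - j) / 2)]
    simp

end Step

end

end InvolutionWalk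

theorem mainTheorem9 (n i : ℕ) (hn : Even n) (hi : i < n) (p : ℝ) :
    InvolutionWalk.psi n p (InvolutionWalk.hook n i hi) =
      (((∑ j ∈ (Finset.range (i + 1)).filter (fun j => Even (i - j) ∧ i + j + 2 ≤ n),
            (InvolutionWalk.trinomial (n / 2 - 1) j ((i - j) / 2) ((n - i - j - 2) / 2) : ℝ)
              / ((n - 1).choose i : ℝ) * (2 * p) ^ j * (2 * p - 1) ^ ((i - j) / 2))
        + ∑ j ∈ (Finset.range i).filter (fun j => Odd (i - j) ∧ i + j + 1 ≤ n),
            (InvolutionWalk.trinomial (n / 2 - 1) j ((i - j - 1) / 2) ((n - i - j - 1) / 2) : ℝ)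
              / ((n - 1).choose i : ℝ) * (2 * p) ^ j * (2 * p - 1) ^ ((i - j - 1) / 2 + 1)
        : ℝ) : ℂ) := by
  obtain ⟨m, rfl⟩ := even_iff_exists_two_mul.mp hn
  rw [InvolutionWalk.psi_hook, mul_one_add, Polynomial.coeff_add, add_div,
    InvolutionWalk.coeff_trinomial_pow, Finset.sum_div]
  push_cast
  congr 1
  · refine Finset.sum_congr (Finset.filter_congr fun j _ => by
      rw [show i + j + 2 ≤ 2 * m ↔ i + j ≤ 2 * (m - 1) by omega]) fun j _ => ?_
    rw [show 2 * m / 2 = m by omega, show 2 * (m - 1) - i - j = 2 * m - i - j - 2 by omega]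
    ring
  -- The term `(2p-1)X` shifts the degree to `i - 1` and supplies the extra factor `2p-1`; for `i =
  -- 0` both sides are zero.
  · rcases i with _ | i
    · simp
    · rw [← mul_assoc, Polynomial.coeff_mul_X, Polynomial.coeff_mul_C,
        InvolutionWalk.coeff_trinomial_pow, Finset.sum_mul, Finset.sum_div]
      refine Finset.sum_congr (Finset.filter_congr fun j hj => ?_) fun j hj => ?_
      · rw [Finset.mem_range] at hj
        rw [show i + 1 - j = i - j + 1 by omega, Nat.odd_add_one, Nat.not_odd_iff_even,
          show i + 1 + j + 1 ≤ 2 * m ↔ i + j ≤ 2 * (m - 1) by omega]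
      · rw [show 2 * m / 2 = m by omega, show i + 1 - j - 1 = i - j by omega,
          show 2 * (m - 1) - i - j = 2 * m - (i + 1) - j - 1 by omega]
        ring
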